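/- Let $\mathcal A=\{a_1,\dots,a_n\}$ be a finite set of $n$ colors, $D\subseteq\mathbb Z^2$ a finite set (a shape) and $\mathbf B=(b_{ij})$ an $n\times n$ matrix of non-negative integers. A $(D,\mathbf B)$-coloring is a map $c\colon\mathbb Z^2\to\mathcal A$ such that for all $i,j$ and every $\vec u\in\mathbb Z^2$ with $c(\vec u)=a_j$, exactly $b_{ij}$ of the points of $\vec u+D$ have color $a_i$. For $t\in\mathbb C$ consider the Laurent polynomial $f_D-t=\sum_{(u_1,u_2)\in D}x^{-u_1}y^{-u_2}-t\in\mathbb C[x^{\pm1},y^{\pm1}]$. A line polynomial is a Laurent polynomial whose support contains at least two points and is contained in a line; a line polynomial factor of $f$ is a line polynomial dividing $f$ in $\mathbb C[x^{\pm1},y^{\pm1}]$. Theorem. Let a finite shape $D\subseteq\mathbb Z^2$, a non-negative integer $n\times n$ matrix $\mathbf B$ and an integer $t_0$ be given such that $f_D-t$ has no line polynomial factors for any complex number $t\neq t_0$, and $\det(\mathbf B-t_0\mathbf I)\neq0$. Then there are only finitely many $(D,\mathbf B)$-colorings, and they can be effectively constructed: there is a single algorithm (a partial recursive function) that, on every input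 $(D,\mathbf B,t_0)$ satisfying these hypotheses (with $n$ part of the input), halts and outputs a finite list that describes exactly the $(D,\mathbf B)$-colorings, each of them once; here a coloring $c$ is described by its values on a rectangle $\{0,\dots,p-1\}\times\{0,\dots,q-1\}$ for some $p,q\ge1$ such that $(p,0)$ and $(0,q)$ are periods of $c$. In particular, there is an algorithm that, on every input $(D,\mathbf B,t_0)$ satisfying these hypotheses, halts and determines whether there exists a $(D,\mathbf B)$-coloring. -/

import Mathlib

namespace PerfectColoring

/-- Laurent polynomials in the two variables `x, y` with complex coefficients:
the exponents are the vectors of `ℤ × ℤ`. -/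
abbrev LaurentPoly : Type := AddMonoidAlgebra ℂ (ℤ × ℤ)

/-- A line polynomial: its support has at least two points, and all the points of the support
lie on one line `u + ℚ v`. -/
def IsLinePolynomial (f : LaurentPoly) : Prop :=
  2 ≤ f.coeff.support.card ∧
    ∃ u v : ℤ × ℤ, ∀ w ∈ f.coeff.support, ∃ q : ℚ,
      (w.1 : ℚ) = u.1 + q * v.1 ∧ (w.2 : ℚ) = u.2 + q * v.2

/-- `f` has a line polynomial factor in the ring `ℂ[x^±1, y^±1]`. -/
def HasLinePolynomialFactor (f : LaurentPoly) : Prop :=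
  ∃ g : LaurentPoly, IsLinePolynomial g ∧ g ∣ f

/-- The characteristic polynomial `f_D = ∑_{u ∈ D} X^{-u}` of a finite shape. -/
noncomputable def shapePoly (D : Finset (ℤ × ℤ)) : LaurentPoly :=
  ∑ u ∈ D, AddMonoidAlgebra.single (-u) 1

/-- The polynomial `f_D - t`. -/
noncomputable def shiftedShapePoly (D : Finset (ℤ × ℤ)) (t : ℂ) : LaurentPoly :=
  shapePoly D - AddMonoidAlgebra.single 0 t

/-- `c` is a `(D, B)`-coloring (with colors `0, …, n - 1`): for every cell `u` of color `j` and
every color `i`, the number of cells of color `i` in `u + D` is the entry `B i j`. -/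
def IsColoring {n : ℕ} (D : Finset (ℤ × ℤ)) (B : Matrix (Fin n) (Fin n) ℕ)
    (c : ℤ × ℤ → Fin n) : Prop :=
  ∀ (i j : Fin n) (u : ℤ × ℤ), c u = j → (D.filter fun d => c (u + d) = i).card = B i j

/-- The hypotheses on `D`, `B` and `t₀`. -/
def Admissible {n : ℕ} (D : Finset (ℤ × ℤ)) (B : Matrix (Fin n) (Fin n) ℕ) (t₀ : ℤ) : Prop :=
  (∀ t : ℂ, t ≠ (t₀ : ℂ) → ¬ HasLinePolynomialFactor (shiftedShapePoly D t)) ∧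
    (B.map (fun b : ℕ => (b : ℤ)) - t₀ • (1 : Matrix (Fin n) (Fin n) ℤ)).det ≠ 0

/-- The type of inputs of the algorithms: a list of the cells of `D`, the list of the rows
of `B`, and `t₀`. -/
abbrev Input : Type := List (ℤ × ℤ) × List (List ℕ) × ℤ

/-- The list of the rows of a matrix. -/
def rows {n : ℕ} (B : Matrix (Fin n) (Fin n) ℕ) : List (List ℕ) :=
  List.ofFn fun i => List.ofFn fun j => B i j

/-- The finite table `T` describes the configuration `c`: for some `p, q ≥ 1`, `c` has the periods
`(p, 0)` and `(0, q)`, and `T` lists the colors of `c` on the cells of `[0, p) × [0, q)`. As `p` and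
`q` can be read off from `T`, the table determines `c`. -/
def IsTableOf {n : ℕ} (T : List (List ℕ)) (c : ℤ × ℤ → Fin n) : Prop :=
  ∃ p q : ℕ, 0 < p ∧ 0 < q ∧
    (∀ u : ℤ × ℤ, c (u + ((p : ℤ), 0)) = c u) ∧
    (∀ u : ℤ × ℤ, c (u + (0, (q : ℤ))) = c u) ∧
    T = List.ofFn fun i : Fin p => List.ofFn fun j : Fin q =>
      (c (((i : ℕ) : ℤ), ((j : ℕ) : ℤ)) : ℕ)

/-- The list of tables `out` describes, one by one and without repetition, exactly the
`(D, B)`-colorings. -/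
def ListsAllColorings {n : ℕ} (D : Finset (ℤ × ℤ)) (B : Matrix (Fin n) (Fin n) ℕ)
    (out : List (List (List ℕ))) : Prop :=
  ∃ cs : List (ℤ × ℤ → Fin n), cs.Nodup ∧ (∀ c, c ∈ cs ↔ IsColoring D B c) ∧
    List.Forall₂ IsTableOf out cs

end PerfectColoring

/-! Numbering the colors turns a coloring into a bounded integer function on the plane, on which
Laurent polynomials act by translations. The polynomial `f_D` acts through the transpose of `B`, so
by Cayley–Hamilton the characteristic polynomial of `B`, evaluated at `f_D`, annihilates every
coloring. Over `ℂ` this annihilator is the product of the `f_D - z` over the eigenvalues `z`. The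
determinant condition gives `z ≠ t₀`, so no factor has a line polynomial factor.

Frobenius modulo large primes shows that if `∑ a_v X^v` annihilates a bounded integer function, then
so does `∑ a_v X^{(1+rj)v}` for a fixed `r` and all `j` (`sum_dilate_progression_eq_zero`). Modulo a
prime ideal containing all common annihilators, Dedekind independence of characters then forces
`X^{r(v-w)} = 1` for some `v ≠ w` (`exists_ne_map_single_eq_one`). Some `f_D - z` vanishes there as
well, and having no line polynomial factor it makes all monomials constant
(`exists_algebraMap_eq_map_single`). Hence the annihilator ideal contains a nonzero polynomial in
each `X^e`. The resulting recurrences in two directions let a finite box determine a coloring: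
`Admissible.finite_colorings`.

Translations permute the finite set of colorings, so there is a common period `P`. By compactness,
periodicity already follows from the local rules on some finite region (`exists_isCertificate`). An
algorithm can search for such a region and period, then test all `P`-periodic configurations. -/

namespace PerfectColoring

open Polynomial

/-! ### Translation action of the group algebra, and dilation of annihilators. -/

section ShiftAction

variable {G : Type*} [AddCommGroup G] {k : Type*} [CommRing k]

/-- The translation `h ↦ h (· - v)` of functions on a group, as a representation. -/
def translation (G k : Type*) [AddCommGroup G] [CommRing k] :
    Multiplicative G →* Module.End k (G → k) where
  toFun v := { toFun := fun h u => h (u - v.toAdd)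
               map_add' := fun _ _ => rfl
               map_smul' := fun _ _ => rfl }
  map_one' := by ext; simp
  map_mul' v w := by
    refine LinearMap.ext fun h => funext fun u => ?_
    simp [sub_sub]

/-- The group algebra acts on functions on the group by translations: `X^v • h = h (· - v)`. -/
noncomputable def shiftAction (G k : Type*) [AddCommGroup G] [CommRing k] :
    AddMonoidAlgebra k G →ₐ[k] Module.End k (G → k) :=
  AddMonoidAlgebra.lift k _ G (translation G k)

@[simp] lemma shiftAction_single (v : G) (a : k) (h : G → k) (u : G) :
    shiftAction G k (AddMonoidAlgebra.single v a) h u = a * h (u - v) := by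
  simp [shiftAction, AddMonoidAlgebra.lift_single, translation]

lemma shiftAction_sum_single {ι : Type*} (s : Finset ι) (a : ι → k) (v : ι → G) (h : G → k)
    (u : G) : shiftAction G k (∑ i ∈ s, AddMonoidAlgebra.single (v i) (a i)) h u =
      ∑ i ∈ s, a i * h (u - v i) := by
  simp [map_sum, LinearMap.sum_apply, Finset.sum_apply]

omit [AddCommGroup G] in
lemma eq_sum_single (f : AddMonoidAlgebra k G) :
    f = ∑ v ∈ f.coeff.support, AddMonoidAlgebra.single v (f.coeff v) := by
  apply AddMonoidAlgebra.coeff_injective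
  rw [AddMonoidAlgebra.coeff_sum]
  exact (Finsupp.sum_single f.coeff).symm

lemma shiftAction_apply (f : AddMonoidAlgebra k G) (h : G → k) (u : G) :
    shiftAction G k f h u = ∑ v ∈ f.coeff.support, f.coeff v * h (u - v) := by
  conv_lhs => rw [eq_sum_single f]
  exact shiftAction_sum_single _ _ _ _ _

/-- If an integer polynomial annihilates a bounded integer-valued function, so does its dilation
by a large prime. -/
lemma sum_dilate_prime_eq_zero {ι : Type*} (s : Finset ι) (a : ι → ℤ) (v : ι → G) (h : G → ℤ)
    (b : ℤ) (hb : ∀ u, |h u| ≤ b) (h0 : ∀ u, ∑ i ∈ s, a i * h (u - v i) = 0)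
    (p : ℕ) (hp : p.Prime) (hlt : (∑ i ∈ s, |a i|) * b < p) (u : G) :
    ∑ i ∈ s, a i * h (u - p • v i) = 0 := by
  have : Fact p.Prime := ⟨hp⟩
  have : CharP (AddMonoidAlgebra (ZMod p) G) p :=
    charP_of_injective_algebraMap
      (FaithfulSMul.algebraMap_injective (ZMod p) (AddMonoidAlgebra (ZMod p) G)) p
  set f : AddMonoidAlgebra (ZMod p) G := ∑ i ∈ s, AddMonoidAlgebra.single (v i) (a i : ZMod p)
    with hf
  set h' : G → ZMod p := fun u => (h u : ZMod p) with hh'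
  have hfh : shiftAction G (ZMod p) f h' = 0 := by
    funext u
    rw [hf, shiftAction_sum_single]
    have := congrArg (Int.cast : ℤ → ZMod p) (h0 u)
    push_cast at this
    simpa using this
  -- Frobenius is additive in characteristic `p` and fixes the coefficients by Fermat, so only the
  -- exponents are dilated. The integer sum is therefore divisible by `p`, and the bound makes it
  -- smaller than `p`.
  have hfp : f ^ p = ∑ i ∈ s, AddMonoidAlgebra.single (p • v i) (a i : ZMod p) := by
    rw [hf, sum_pow_char]
    refine Finset.sum_congr rfl fun i _ => ?_
    rw [AddMonoidAlgebra.single_pow, ZMod.pow_card]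
  have hfph : shiftAction G (ZMod p) (f ^ p) h' u = 0 := by
    rw [← pow_sub_one_mul hp.ne_zero f, map_mul, Module.End.mul_apply, hfh, map_zero]
    rfl
  rw [hfp, shiftAction_sum_single] at hfph
  have hdvd : (p : ℤ) ∣ ∑ i ∈ s, a i * h (u - p • v i) := by
    rw [← ZMod.intCast_zmod_eq_zero_iff_dvd]
    push_cast
    exact hfph
  refine Int.eq_zero_of_abs_lt_dvd hdvd (lt_of_le_of_lt ?_ hlt)
  refine (Finset.abs_sum_le_sum_abs _ _).trans ?_
  rw [Finset.sum_mul]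
  refine Finset.sum_le_sum fun i _ => ?_
  rw [abs_mul]
  exact mul_le_mul_of_nonneg_left (hb _) (abs_nonneg _)

/-- Dilating by one prime factor at a time leaves the coefficients, and so the size bound,
unchanged. The exponents `v` are generalized because each step acts on already dilated ones. -/
lemma sum_dilate_eq_zero {ι : Type*} (s : Finset ι) (a : ι → ℤ) (h : G → ℤ)
    (b : ℤ) (hb : ∀ u, |h u| ≤ b) (m : ℕ) (hm : m ≠ 0)
    (hlt : ∀ p : ℕ, p.Prime → p ∣ m → (∑ i ∈ s, |a i|) * b < p) (v : ι → G)
    (h0 : ∀ u, ∑ i ∈ s, a i * h (u - v i) = 0) (u : G) :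
    ∑ i ∈ s, a i * h (u - m • v i) = 0 := by
  induction m using Nat.recOnMul generalizing v u with
  | zero => exact absurd rfl hm
  | one => simpa using h0 u
  | prime p hp =>
    exact sum_dilate_prime_eq_zero s a v h b hb h0 p hp (hlt p hp dvd_rfl) u
  | mul x y hx hy =>
    have hx0 : x ≠ 0 := left_ne_zero_of_mul hm
    have hy0 : y ≠ 0 := right_ne_zero_of_mul hm
    have := hx hx0 (fun p hp hd => hlt p hp (hd.mul_right y)) (fun i => y • v i)
      (hy hy0 (fun p hp hd => hlt p hp (hd.mul_left x)) v h0) u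
    simpa [mul_smul] using this

/-- An integer polynomial `∑ a_i X^{v_i}` annihilating bounded functions yields annihilators
`∑ a_i X^{m v_i}` for all `m` in an arithmetic progression. -/
lemma sum_dilate_progression_eq_zero {ι : Type*} (s : Finset ι) (a : ι → ℤ) (v : ι → G)
    (b : ℤ) : ∃ r : ℕ, 0 < r ∧ ∀ h : G → ℤ, (∀ u, |h u| ≤ b) →
      (∀ u, ∑ i ∈ s, a i * h (u - v i) = 0) →
      ∀ (j : ℕ) (u : G), ∑ i ∈ s, a i * h (u - (1 + r * j) • v i) = 0 := by
  set C : ℤ := (∑ i ∈ s, |a i|) * b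
  -- A prime at most `C` divides `C!`, hence cannot divide `1 + C! * j`.
  refine ⟨C.toNat.factorial, Nat.factorial_pos _, fun h hb h0 j u => ?_⟩
  refine sum_dilate_eq_zero s a h b hb _ (by omega) (fun p hp hd => ?_) v h0 u
  by_contra hle
  have h1 : p ≤ C.toNat := by omega
  have h2 : p ∣ C.toNat.factorial * j := (hp.dvd_factorial.2 h1).mul_right j
  exact hp.one_lt.ne' (Nat.dvd_one.1 ((Nat.dvd_add_left h2).1 hd))

end ShiftAction

/-! ### An annihilator of colorings from Cayley–Hamilton. -/

/-- The polynomial of a shape, over an arbitrary ring. -/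
noncomputable def shapePolyOver (k : Type*) [CommRing k] (D : Finset (ℤ × ℤ)) :
    AddMonoidAlgebra k (ℤ × ℤ) :=
  ∑ u ∈ D, AddMonoidAlgebra.single (-u) 1

lemma map_shapePolyOver (D : Finset (ℤ × ℤ)) :
    AddMonoidAlgebra.mapRingHom (ℤ × ℤ) (Int.castRingHom ℂ) (shapePolyOver ℤ D) = shapePoly D := by
  simp [shapePolyOver, shapePoly, map_sum]

variable {n : ℕ} {D : Finset (ℤ × ℤ)} {B : Matrix (Fin n) (Fin n) ℕ} {c : ℤ × ℤ → Fin n}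

/-- The negative exponents of `f_D` make its action a sum over `u + D`. Grouping these cells by
color gives a column of `B`, hence the transpose. -/
lemma IsColoring.shiftAction_shapePoly (hc : IsColoring D B c) (a : Fin n → ℤ) :
    shiftAction _ ℤ (shapePolyOver ℤ D) (a ∘ c) =
      ((B.map (fun b : ℕ => (b : ℤ))).transpose.mulVec a) ∘ c := by
  funext u
  rw [shapePolyOver, shiftAction_sum_single]
  simp only [one_mul, sub_neg_eq_add, Function.comp_apply, Matrix.mulVec, dotProduct,
    Matrix.transpose_apply, Matrix.map_apply]
  rw [← Finset.sum_fiberwise D (fun d => c (u + d))]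
  refine Finset.sum_congr rfl fun i _ => ?_
  rw [← hc i (c u) u rfl, Finset.sum_congr rfl (g := fun _ => a i), Finset.sum_const]
  · simp
  · intro d hd
    rw [(Finset.mem_filter.1 hd).2]

lemma IsColoring.shiftAction_aeval (hc : IsColoring D B c) (P : ℤ[X]) (a : Fin n → ℤ) :
    shiftAction _ ℤ (aeval (shapePolyOver ℤ D) P) (a ∘ c) =
      ((aeval (B.map (fun b : ℕ => (b : ℤ))).transpose P).mulVec a) ∘ c := by
  induction P using Polynomial.induction_on' generalizing a with
  | add p q hp hq =>
    rw [map_add, map_add, map_add, LinearMap.add_apply, hp, hq, Matrix.add_mulVec]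
    rfl
  | monomial m z =>
    rw [aeval_monomial, aeval_monomial]
    induction m generalizing a with
    | zero =>
      funext u
      simp
    | succ m ih =>
      rw [pow_succ, ← mul_assoc, map_mul, Module.End.mul_apply, hc.shiftAction_shapePoly, ih,
        pow_succ, ← mul_assoc, Matrix.mulVec_mulVec]

/-- The characteristic polynomial of `B`, evaluated at the polynomial of the shape. -/
noncomputable def annihilator (D : Finset (ℤ × ℤ)) (B : Matrix (Fin n) (Fin n) ℕ) :
    AddMonoidAlgebra ℤ (ℤ × ℤ) :=
  aeval (shapePolyOver ℤ D) (B.map (fun b : ℕ => (b : ℤ))).charpoly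

lemma IsColoring.shiftAction_annihilator (hc : IsColoring D B c) (a : Fin n → ℤ) :
    shiftAction _ ℤ (annihilator D B) (a ∘ c) = 0 := by
  rw [annihilator, hc.shiftAction_aeval, ← Matrix.charpoly_transpose, Matrix.aeval_self_charpoly,
    Matrix.zero_mulVec]
  rfl

end PerfectColoring

/-! ### Points of the torus with multiplicatively dependent coordinates. -/

namespace PerfectColoring

open Polynomial

/-- In a domain over `ℂ`, an algebraic element is a constant. -/
lemma exists_algebraMap_eq_of_aeval_eq_zero {E : Type*} [CommRing E] [IsDomain E] [Algebra ℂ E]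
    {y : E} {q : ℂ[X]} (hq : q ≠ 0) (h : aeval y q = 0) : ∃ z : ℂ, algebraMap ℂ E z = y := by
  have hs := IsAlgClosed.splits q
  rw [hs.eq_prod_roots, map_mul, aeval_C] at h
  have h1 : algebraMap ℂ E q.leadingCoeff ≠ 0 := by simpa using hq
  have h2 := (mul_eq_zero.1 h).resolve_left h1
  rw [map_multiset_prod, Multiset.prod_eq_zero_iff, Multiset.map_map, Multiset.mem_map] at h2
  obtain ⟨z, -, hz⟩ := h2
  refine ⟨z, ?_⟩
  simp only [Function.comp_apply, map_sub, aeval_X, aeval_C] at hz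
  exact (sub_eq_zero.1 hz).symm

section Monomials

variable {G : Type*} [AddCommGroup G]

/-- The monomials `X^v` as units. -/
noncomputable def monomialUnit (G : Type*) [AddCommGroup G] :
    Multiplicative G →* (AddMonoidAlgebra ℂ G)ˣ :=
  (AddMonoidAlgebra.of ℂ G).toHomUnits

lemma val_monomialUnit (v : G) :
    (monomialUnit G (Multiplicative.ofAdd v) : AddMonoidAlgebra ℂ G) =
      AddMonoidAlgebra.single v 1 := rfl

variable {Q : Type*} [CommRing Q] [Algebra ℂ Q]

lemma map_single_zsmul (θ : AddMonoidAlgebra ℂ G →ₐ[ℂ] Q) {v : G} {ζ : ℂ} (hζ : ζ ≠ 0)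
    (h : θ (AddMonoidAlgebra.single v 1) = algebraMap ℂ Q ζ) (s : ℤ) :
    θ (AddMonoidAlgebra.single (s • v) 1) = algebraMap ℂ Q (ζ ^ s) := by
  have h1 : Units.map (θ : _ →* Q) (monomialUnit G (Multiplicative.ofAdd v)) =
      Units.map (algebraMap ℂ Q : ℂ →* Q) (Units.mk0 ζ hζ) := by
    ext
    simpa [val_monomialUnit] using h
  have h2 : Units.map (θ : _ →* Q) (monomialUnit G (Multiplicative.ofAdd (s • v))) =
      Units.map (algebraMap ℂ Q : ℂ →* Q) (Units.mk0 ζ hζ ^ s) := by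
    rw [ofAdd_zsmul, map_zpow, map_zpow, map_zpow, h1]
  have h3 := congrArg (Units.val : Qˣ → Q) h2
  rwa [Units.coe_map, Units.coe_map, val_monomialUnit, Units.val_zpow_eq_zpow_val] at h3

lemma single_add_one (v w : G) : (AddMonoidAlgebra.single (v + w) 1 : AddMonoidAlgebra ℂ G) =
    AddMonoidAlgebra.single v 1 * AddMonoidAlgebra.single w 1 := by
  rw [AddMonoidAlgebra.single_mul_single, one_mul]

end Monomials

/-- The Laurent polynomials in `X^w`. -/
noncomputable def substMonomial (w : ℤ × ℤ) : LaurentPolynomial ℂ →ₐ[ℂ] LaurentPoly :=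
  AddMonoidAlgebra.mapDomainAlgHom ℂ ℂ (zmultiplesHom (ℤ × ℤ) w)

/-- The homomorphism `X^v ↦ ζ^(s v) T^(t v)`. -/
noncomputable def specialize (s t : ℤ × ℤ →+ ℤ) (ζ : ℂˣ) : LaurentPoly →ₐ[ℂ] LaurentPolynomial ℂ :=
  AddMonoidAlgebra.lift ℂ _ _
    { toFun := fun v => LaurentPolynomial.C ((ζ ^ s v.toAdd : ℂˣ) : ℂ) *
        LaurentPolynomial.T (t v.toAdd)
      map_one' := by simp
      map_mul' := fun v w => by
        simp only [toAdd_mul, map_add, zpow_add, Units.val_mul, map_mul, LaurentPolynomial.T_add]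
        ring }

lemma specialize_single (s t : ℤ × ℤ →+ ℤ) (ζ : ℂˣ) (v : ℤ × ℤ) :
    specialize s t ζ (AddMonoidAlgebra.single v 1) =
      LaurentPolynomial.C ((ζ ^ s v : ℂˣ) : ℂ) * LaurentPolynomial.T (t v) := by
  simp [specialize]

lemma substMonomial_T (w : ℤ × ℤ) (m : ℤ) :
    substMonomial w (LaurentPolynomial.T m) = AddMonoidAlgebra.single (m • w) 1 := by
  change AddMonoidAlgebra.mapDomain (zmultiplesHom (ℤ × ℤ) w) (AddMonoidAlgebra.single m 1) = _
  rw [AddMonoidAlgebra.mapDomain_single, zmultiplesHom_apply]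

variable {Q : Type*} [CommRing Q] [Algebra ℂ Q]

/-- In the coordinates `u, w`, a homomorphism sending `X^u` to the constant `ζ` factors through the
substitution `X^u = ζ`, which leaves only the variable `X^w`. -/
lemma comp_specialize (s t : ℤ × ℤ →+ ℤ) (ζ : ℂˣ) (u w : ℤ × ℤ)
    (hst : ∀ v, v = s v • u + t v • w) (θ : LaurentPoly →ₐ[ℂ] Q)
    (hθ : θ (AddMonoidAlgebra.single u 1) = algebraMap ℂ Q ζ) :
    θ = (θ.comp (substMonomial w)).comp (specialize s t ζ) := by
  refine AddMonoidAlgebra.algHom_ext (fun v => ?_) (Subsingleton.elim _ _)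
  rw [AlgHom.comp_apply, AlgHom.comp_apply]
  have h1 : (LaurentPolynomial.C ((ζ ^ s v : ℂˣ) : ℂ) : LaurentPolynomial ℂ) =
    algebraMap ℂ _ ((ζ ^ s v : ℂˣ) : ℂ) := rfl
  rw [specialize_single, map_mul, h1, AlgHom.commutes, map_mul, AlgHom.commutes, substMonomial_T]
  conv_lhs => rw [hst v]
  rw [single_add_one, map_mul, map_single_zsmul θ ζ.ne_zero hθ, Units.val_zpow_eq_zpow_val]

lemma isLinePolynomial_single_sub {u : ℤ × ℤ} (hu : u ≠ 0) {ζ : ℂ} (hζ : ζ ≠ 0) :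
    IsLinePolynomial (AddMonoidAlgebra.single u 1 - AddMonoidAlgebra.single 0 ζ) := by
  have hs : (AddMonoidAlgebra.single u 1 - AddMonoidAlgebra.single 0 ζ : LaurentPoly).coeff.support
      = {u, 0} := by
    ext w
    simp only [AddMonoidAlgebra.coeff_sub, AddMonoidAlgebra.coeff_single, Finsupp.mem_support_iff,
      Finsupp.sub_apply, Finset.mem_insert, Finset.mem_singleton]
    by_cases h1 : w = u
    · subst h1
      simp [hu]
    · by_cases h2 : w = 0
      · subst h2
        simp [hu, hζ]
      · simp [h1, h2]
  refine ⟨by rw [hs, Finset.card_pair hu], 0, u, fun w hw => ?_⟩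
  rw [hs, Finset.mem_insert, Finset.mem_singleton] at hw
  rcases hw with rfl | rfl
  · exact ⟨1, by simp⟩
  · exact ⟨0, by simp⟩

/-- If a polynomial without line polynomial factors vanishes at a point of the torus over a domain
with multiplicatively dependent coordinates, then the coordinates of the point are constants. -/
lemma exists_algebraMap_eq_map_single [IsDomain Q] (π : LaurentPoly →ₐ[ℂ] Q) {u : ℤ × ℤ}
    (hu : u ≠ 0) (hπu : π (AddMonoidAlgebra.single u 1) = 1) {g : LaurentPoly}
    (hg : ¬ HasLinePolynomialFactor g) (hπg : π g = 0) (v : ℤ × ℤ) :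
    ∃ z : ℂ, algebraMap ℂ Q z = π (AddMonoidAlgebra.single v 1) := by
  obtain ⟨a, b⟩ := u
  have hab : ¬ (a = 0 ∧ b = 0) := by simpa [Prod.ext_iff] using hu
  have hd : Int.gcd a b ≠ 0 := by
    intro h
    exact hab (Int.gcd_eq_zero_iff.1 h)
  obtain ⟨a', ha'⟩ := Int.gcd_dvd_left a b
  obtain ⟨b', hb'⟩ := Int.gcd_dvd_right a b
  set d := Int.gcd a b with hdd
  have hbez : ∃ α β : ℤ, α * a' + β * b' = 1 := by
    refine ⟨Int.gcdA a b, Int.gcdB a b, ?_⟩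
    have h := Int.gcd_eq_gcd_ab a b
    have hd' : (d : ℤ) ≠ 0 := by exact_mod_cast hd
    apply mul_left_cancel₀ hd'
    rw [← hdd] at h
    linear_combination Int.gcdA a b * (-ha') + Int.gcdB a b * (-hb') - h
  obtain ⟨α, β, hαβ⟩ := hbez
  -- The primitive vector `u₀` along `u` is completed by `w₀` to a basis of `ℤ × ℤ`, with
  -- determinant 1 by Bézout.
  set u₀ : ℤ × ℤ := (a', b') with hu₀
  set w₀ : ℤ × ℤ := (-β, α) with hw₀
  have hu₀0 : u₀ ≠ 0 := by
    intro h
    simp only [hu₀, Prod.mk_eq_zero] at h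
    rw [h.1, h.2] at hαβ
    simp at hαβ
  have hpow : π (AddMonoidAlgebra.single u₀ 1) ^ d = 1 := by
    rw [← map_pow, AddMonoidAlgebra.single_pow, one_pow, ← hπu]
    congr 3
    simp only [hu₀, Prod.smul_mk, nsmul_eq_mul, Prod.mk.injEq]
    exact ⟨ha'.symm, hb'.symm⟩
  obtain ⟨ζ, hζ⟩ := exists_algebraMap_eq_of_aeval_eq_zero (q := (X ^ d - 1 : ℂ[X]))
    (X_pow_sub_C_ne_zero (Nat.pos_of_ne_zero hd) 1) (y := π (AddMonoidAlgebra.single u₀ 1))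
    (by simp [hpow])
  have hζ0 : ζ ≠ 0 := by
    rintro rfl
    rw [← hζ, map_zero, zero_pow hd] at hpow
    exact zero_ne_one hpow
  let s : ℤ × ℤ →+ ℤ := α • AddMonoidHom.fst ℤ ℤ + β • AddMonoidHom.snd ℤ ℤ
  let t : ℤ × ℤ →+ ℤ := (-b') • AddMonoidHom.fst ℤ ℤ + a' • AddMonoidHom.snd ℤ ℤ
  have hst : ∀ v, v = s v • u₀ + t v • w₀ := by
    rintro ⟨x, y⟩
    simp only [s, t, hu₀, hw₀, AddMonoidHom.add_apply, AddMonoidHom.coe_smul, Pi.smul_apply,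
      AddMonoidHom.coe_fst, AddMonoidHom.coe_snd, smul_eq_mul, Prod.smul_mk, Prod.mk_add_mk,
      Prod.mk.injEq]
    constructor
    · linear_combination -x * hαβ
    · linear_combination -y * hαβ
  set ζ' : ℂˣ := Units.mk0 ζ hζ0
  set φ := specialize s t ζ'
  -- If `φ g` were zero, `g` would vanish modulo `X^{u₀} - ζ`, which would then be a line polynomial
  -- factor.
  have hφg : φ g ≠ 0 := by
    intro h
    apply hg
    refine ⟨_, isLinePolynomial_single_sub hu₀0 hζ0, ?_⟩
    rw [← Ideal.mem_span_singleton, ← Ideal.Quotient.eq_zero_iff_mem]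
    set l : LaurentPoly := AddMonoidAlgebra.single u₀ 1 - AddMonoidAlgebra.single 0 ζ with hl
    have h0 : Ideal.Quotient.mkₐ ℂ (Ideal.span {l}) (AddMonoidAlgebra.single u₀ 1) =
        algebraMap ℂ _ (ζ' : ℂ) := by
      rw [← AlgHom.commutes (Ideal.Quotient.mkₐ ℂ (Ideal.span {l}))]
      refine Ideal.Quotient.eq.2 (Ideal.subset_span ?_)
      rw [Set.mem_singleton_iff, hl]
      rfl
    have h1 := comp_specialize s t ζ' u₀ w₀ hst _ h0
    have h2 := DFunLike.congr_fun h1 g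
    rw [AlgHom.comp_apply, h, map_zero] at h2
    exact h2
  -- After clearing negative powers, `φ g` is a nonzero one-variable polynomial with root `π
  -- (X^{w₀})`, so this element is algebraic over `ℂ`.
  have hW : ∃ μ : ℂ, algebraMap ℂ Q μ = π (AddMonoidAlgebra.single w₀ 1) := by
    obtain ⟨N, q, hq⟩ := LaurentPolynomial.exists_T_pow (φ g)
    have hq0 : q ≠ 0 := by
      rintro rfl
      rw [map_zero] at hq
      exact hφg ((LaurentPolynomial.isUnit_T N).mul_left_eq_zero.1 hq.symm)
    refine exists_algebraMap_eq_of_aeval_eq_zero hq0 ?_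
    have h1 := comp_specialize s t ζ' u₀ w₀ hst π hζ.symm
    have h2 := DFunLike.congr_fun h1 g
    rw [AlgHom.comp_apply, hπg] at h2
    have h3 : aeval (π (AddMonoidAlgebra.single w₀ 1)) =
        (π.comp (substMonomial w₀)).comp toLaurentAlg := by
      apply Polynomial.algHom_ext
      rw [aeval_X, AlgHom.comp_apply, toLaurentAlg_apply, toLaurent_X, AlgHom.comp_apply,
        substMonomial_T, one_smul]
    rw [h3, AlgHom.comp_apply, toLaurentAlg_apply, hq, map_mul, ← h2, zero_mul]
  obtain ⟨μ, hμ⟩ := hW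
  have hμ0 : μ ≠ 0 := by
    rintro rfl
    rw [map_zero] at hμ
    have h1 := ((monomialUnit _ (Multiplicative.ofAdd w₀)).isUnit.map π).ne_zero
    rw [val_monomialUnit] at h1
    exact h1 hμ.symm
  refine ⟨ζ ^ s v * μ ^ t v, ?_⟩
  rw [map_mul, ← map_single_zsmul π hζ0 hζ.symm, ← map_single_zsmul π hμ0 hμ.symm, ← map_mul,
    ← single_add_one, ← hst]

end PerfectColoring

/-! ### The common annihilator ideal and finiteness. -/

namespace PerfectColoring

open Polynomial

variable {n : ℕ} {D : Finset (ℤ × ℤ)} {B : Matrix (Fin n) (Fin n) ℕ} {t₀ : ℤ}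

/-- The ideal of the polynomials annihilating all the `(D, B)`-colorings. -/
noncomputable def coloringIdeal (D : Finset (ℤ × ℤ)) (B : Matrix (Fin n) (Fin n) ℕ) :
    Ideal LaurentPoly where
  carrier := {g | ∀ c, IsColoring D B c →
    shiftAction _ ℂ g (fun u => ((c u : ℕ) : ℂ)) = 0}
  add_mem' hf hg c hc := by rw [map_add, LinearMap.add_apply, hf c hc, hg c hc, add_zero]
  zero_mem' c _ := by rw [map_zero, LinearMap.zero_apply]
  smul_mem' a g hg c hc := by
    rw [smul_eq_mul, map_mul, Module.End.mul_apply, hg c hc, map_zero]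

lemma mem_coloringIdeal {g : LaurentPoly} : g ∈ coloringIdeal D B ↔ ∀ c, IsColoring D B c →
    shiftAction _ ℂ g (fun u => ((c u : ℕ) : ℂ)) = 0 := Iff.rfl

/-- All colorings take values bounded by `n`, so one `r` serves them all. -/
lemma exists_dilate_annihilator_mem (D : Finset (ℤ × ℤ)) (B : Matrix (Fin n) (Fin n) ℕ) :
    ∃ r : ℕ, 0 < r ∧ ∀ j : ℕ,
      ∑ v ∈ (annihilator D B).coeff.support, (AddMonoidAlgebra.single ((1 + r * j) • v)
        (((annihilator D B).coeff v : ℤ) : ℂ) : LaurentPoly) ∈ coloringIdeal D B := by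
  obtain ⟨r, hr, H⟩ := sum_dilate_progression_eq_zero (annihilator D B).coeff.support
    (annihilator D B).coeff id n
  refine ⟨r, hr, fun j => mem_coloringIdeal.2 fun c hc => funext fun u => ?_⟩
  rw [shiftAction_sum_single]
  have h1 := H (fun u => ((c u : ℕ) : ℤ)) (fun u => by
      rw [Nat.abs_cast]
      exact_mod_cast (c u).2.le) (fun u => by
      have := congrFun (hc.shiftAction_annihilator (fun i => ((i : ℕ) : ℤ))) u
      rw [shiftAction_apply] at this
      exact this) j u
  have h2 := congrArg (Int.cast : ℤ → ℂ) h1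
  push_cast at h2
  exact h2

lemma map_annihilator (D : Finset (ℤ × ℤ)) (B : Matrix (Fin n) (Fin n) ℕ) :
    AddMonoidAlgebra.mapRingHom (ℤ × ℤ) (Int.castRingHom ℂ) (annihilator D B) =
      ((((B.map (fun b : ℕ => (b : ℤ))).charpoly.map (Int.castRingHom ℂ)).roots).map
        fun z => shiftedShapePoly D z).prod := by
  set χ := (B.map (fun b : ℕ => (b : ℤ))).charpoly with hχ
  have h1 : AddMonoidAlgebra.mapRingHom (ℤ × ℤ) (Int.castRingHom ℂ) (annihilator D B) =
      aeval (shapePoly D) (χ.map (Int.castRingHom ℂ)) := by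
    rw [annihilator, ← hχ, ← map_shapePolyOver, aeval_def, hom_eval₂, aeval_def, eval₂_map]
    congr 1
    exact RingHom.ext_int _ _
  have hm : (χ.map (Int.castRingHom ℂ)).Monic := (Matrix.charpoly_monic _).map _
  rw [h1]
  conv_lhs => rw [(IsAlgClosed.splits (χ.map (Int.castRingHom ℂ))).eq_prod_roots]
  rw [hm.leadingCoeff, map_one, one_mul, map_multiset_prod, Multiset.map_map]
  congr 1
  refine Multiset.map_congr rfl fun z _ => ?_
  rw [Function.comp_apply, map_sub, aeval_X, aeval_C]
  rfl

lemma Admissible.ne_of_mem_roots (h : Admissible D B t₀) {z : ℂ}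
    (hz : z ∈ ((B.map (fun b : ℕ => (b : ℤ))).charpoly.map (Int.castRingHom ℂ)).roots) :
    z ≠ t₀ := by
  rintro rfl
  have h1 := (mem_roots'.1 hz).2
  rw [IsRoot.def, show ((t₀ : ℤ) : ℂ) = Int.castRingHom ℂ t₀ from rfl, eval_map_apply,
    Matrix.eval_charpoly] at h1
  have h2 : (Matrix.scalar (Fin n) t₀ - B.map (fun b : ℕ => (b : ℤ))).det = 0 := by
    rw [eq_intCast] at h1
    exact_mod_cast h1
  apply h.2
  rw [← neg_sub, Matrix.det_neg]
  rw [show t₀ • (1 : Matrix (Fin n) (Fin n) ℤ) = Matrix.scalar (Fin n) t₀ by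
    rw [Matrix.scalar_apply, Matrix.smul_one_eq_diagonal], h2, mul_zero]

/-- The line factor hypothesis thus also says that `f_D - z` is nonzero, which makes the annihilator
nonzero. -/
lemma hasLinePolynomialFactor_zero : HasLinePolynomialFactor 0 :=
  ⟨_, isLinePolynomial_single_sub (u := (1, 0)) (by simp) one_ne_zero, dvd_zero _⟩

lemma Admissible.annihilator_ne_zero (h : Admissible D B t₀) : annihilator D B ≠ 0 := by
  intro h0
  have h1 := map_annihilator D B
  rw [h0, map_zero] at h1
  obtain ⟨z, hz, hz0⟩ := Multiset.mem_map.1 (Multiset.prod_eq_zero_iff.1 h1.symm)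
  exact h.1 z (h.ne_of_mem_roots hz) (hz0 ▸ hasLinePolynomialFactor_zero)

/-- The hypothesis is a linear relation among the characters `j ↦ π (X^{rv})^j` of `ℕ`, with nonzero
coefficients `a v * π (X^v)`. By Dedekind two of these characters coincide. -/
lemma exists_ne_map_single_eq_one {E : Type*} [CommRing E] [IsDomain E] [Algebra ℂ E]
    {G : Type*} [AddCommGroup G]
    (π : AddMonoidAlgebra ℂ G →ₐ[ℂ] E) {s : Finset G} (hs : s.Nonempty) (a : G → ℂ)
    (ha : ∀ v ∈ s, a v ≠ 0) (r : ℕ)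
    (h : ∀ j : ℕ, π (∑ v ∈ s, AddMonoidAlgebra.single ((1 + r * j) • v) (a v)) = 0) :
    ∃ v ∈ s, ∃ w ∈ s, v ≠ w ∧ π (AddMonoidAlgebra.single (r • (v - w)) 1) = 1 := by
  have hunit : ∀ v, π (AddMonoidAlgebra.single v 1) ≠ 0 := fun v =>
    ((monomialUnit G (Multiplicative.ofAdd v)).isUnit.map π).ne_zero
  by_contra! hne
  let ψ : s → (Multiplicative ℕ →* E) := fun v =>
    powersHom E (π (AddMonoidAlgebra.single (r • (v : G)) 1))
  have hψ : Function.Injective ψ := by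
    intro v w hvw
    by_contra hv
    refine hne v v.2 w w.2 (fun h => hv (Subtype.ext h)) ?_
    have h1 : π (AddMonoidAlgebra.single (r • (v : G)) 1) =
        π (AddMonoidAlgebra.single (r • (w : G)) 1) := (powersHom E).injective hvw
    apply mul_right_cancel₀ (hunit (r • (w : G)))
    rw [← map_mul, ← single_add_one, one_mul, ← h1]
    congr 2
    rw [smul_sub, sub_add_cancel]
  have hli := (linearIndependent_monoidHom (Multiplicative ℕ) E).comp ψ hψ
  rw [Fintype.linearIndependent_iff] at hli
  obtain ⟨v, hv⟩ := hs
  have h0 := hli (fun v => π (AddMonoidAlgebra.single (v : G) (a v))) (funext fun j => by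
    refine (Finset.sum_apply _ _ _).trans ?_
    have h1 := h j.toAdd
    rw [map_sum, ← Finset.sum_coe_sort s] at h1
    refine Eq.trans ?_ h1
    refine Finset.sum_congr rfl fun v _ => ?_
    simp only [Function.comp_apply, Pi.smul_apply, ψ, powersHom_apply, smul_eq_mul]
    rw [← map_pow, ← map_mul, AddMonoidAlgebra.single_pow, AddMonoidAlgebra.single_mul_single]
    congr 2
    · rw [add_smul, one_smul, mul_comm r, mul_smul]
    · simp) ⟨v, hv⟩
  rw [show (AddMonoidAlgebra.single v (a v)) = a v • AddMonoidAlgebra.single v (1 : ℂ) by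
    rw [AddMonoidAlgebra.smul_single, smul_eq_mul, mul_one], map_smul] at h0
  exact (smul_ne_zero (ha v hv) (hunit v)) h0

/-- At the common zeros of the annihilators of the colorings the coordinates are constants. -/
lemma Admissible.exists_algebraMap_eq (h : Admissible D B t₀)
    {E : Type*} [CommRing E] [IsDomain E] [Algebra ℂ E] (π : LaurentPoly →ₐ[ℂ] E)
    (hπ : ∀ g ∈ coloringIdeal D B, π g = 0) (v : ℤ × ℤ) :
    ∃ z : ℂ, algebraMap ℂ E z = π (AddMonoidAlgebra.single v 1) := by
  obtain ⟨r, hr, hmem⟩ := exists_dilate_annihilator_mem D B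
  have hs : (annihilator D B).coeff.support.Nonempty := by
    rw [Finsupp.support_nonempty_iff]
    simpa using h.annihilator_ne_zero
  obtain ⟨v₁, -, w₁, -, hne, h1⟩ := exists_ne_map_single_eq_one π hs
    (fun v => (((annihilator D B).coeff v : ℤ) : ℂ))
    (fun v hv => by simpa using hv) r (fun j => hπ _ (hmem j))
  -- The dilation with `j = 0` is the annihilator itself; its product form then makes one factor
  -- vanish in the domain.
  have h0 : π (AddMonoidAlgebra.mapRingHom (ℤ × ℤ) (Int.castRingHom ℂ) (annihilator D B)) = 0 := by
    rw [← hπ _ (hmem 0)]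
    conv_lhs => rw [eq_sum_single (annihilator D B)]
    simp [map_sum]
  rw [map_annihilator, map_multiset_prod, Multiset.prod_eq_zero_iff, Multiset.map_map,
    Multiset.mem_map] at h0
  obtain ⟨z, hz, hz0⟩ := h0
  refine exists_algebraMap_eq_map_single π ?_ h1 (h.1 z (h.ne_of_mem_roots hz)) hz0 v
  exact smul_ne_zero hr.ne' (sub_ne_zero.2 hne)

/-- Otherwise some prime containing the ideal would avoid all nonzero polynomials in `X^e`. But
`X^e` is a constant `z` modulo that prime, which therefore contains `X^e - z`. -/
lemma Admissible.exists_aeval_single_mem (h : Admissible D B t₀) (e : ℤ × ℤ) :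
    ∃ q : ℂ[X], q ≠ 0 ∧
      aeval (AddMonoidAlgebra.single e 1 : LaurentPoly) q ∈ coloringIdeal D B := by
  by_contra! hne
  set S : Submonoid LaurentPoly := (nonZeroDivisors ℂ[X]).map
    (aeval (AddMonoidAlgebra.single e 1 : LaurentPoly) : ℂ[X] →ₐ[ℂ] LaurentPoly) with hS
  have hdisj : Disjoint (coloringIdeal D B : Set LaurentPoly) S := by
    rw [Set.disjoint_left]
    rintro _ hx ⟨q, hq, rfl⟩
    exact hne q (nonZeroDivisors.ne_zero hq) hx
  obtain ⟨P, hP, hle, hPS⟩ := Ideal.exists_le_prime_disjoint _ S hdisj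
  obtain ⟨z, hz⟩ := h.exists_algebraMap_eq (Ideal.Quotient.mkₐ ℂ P)
    (fun g hg => Ideal.Quotient.eq_zero_iff_mem.2 (hle hg)) e
  rw [← AlgHom.commutes (Ideal.Quotient.mkₐ ℂ P), eq_comm] at hz
  have h1 := Ideal.Quotient.eq.1 hz
  refine Set.disjoint_left.1 hPS h1 ⟨X - C z, ?_, ?_⟩
  · exact mem_nonZeroDivisors_of_ne_zero (X_sub_C_ne_zero z)
  · simp

/-- The colorings satisfy a linear recurrence in every direction. -/
lemma Admissible.exists_recurrence (h : Admissible D B t₀) (e : ℤ × ℤ) :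
    ∃ q : ℂ[X], q.coeff 0 ≠ 0 ∧ ∀ c, IsColoring D B c → ∀ u : ℤ × ℤ,
      ∑ j ∈ Finset.range (q.natDegree + 1), q.coeff j * ((c (u - j • e) : ℕ) : ℂ) = 0 := by
  obtain ⟨q, hq, hmem⟩ := h.exists_aeval_single_mem e
  -- Monomials are units, so the power of `X` dividing `q` can be cancelled. The constant
  -- coefficient becomes nonzero and the recurrence reversible.
  obtain ⟨p, hp, hdvd⟩ := exists_eq_pow_rootMultiplicity_mul_and_not_dvd q hq 0
  rw [map_zero, sub_zero] at hp hdvd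
  refine ⟨p, fun h0 => hdvd (X_dvd_iff.2 h0), fun c hc u => ?_⟩
  rw [hp, map_mul, map_pow, aeval_X] at hmem
  have hunit : IsUnit (AddMonoidAlgebra.single e 1 : LaurentPoly) :=
    (monomialUnit _ (Multiplicative.ofAdd e)).isUnit
  have hmem' := (Ideal.unit_mul_mem_iff_mem _ (hunit.pow _)).1 hmem
  have h1 := congrFun (mem_coloringIdeal.1 hmem' c hc) u
  rw [aeval_eq_sum_range] at h1
  simp only [AddMonoidAlgebra.single_pow, one_pow, AddMonoidAlgebra.smul_single, smul_eq_mul,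
    mul_one] at h1
  rw [shiftAction_sum_single] at h1
  exact h1

/-- Both extreme coefficients are nonzero, so the interval of known zeros grows by one at each end.
-/
lemma eq_zero_of_recurrence {q : ℂ[X]} (hq : q.coeff 0 ≠ 0) (f : ℤ → ℂ)
    (hf : ∀ m : ℤ, ∑ j ∈ Finset.range (q.natDegree + 1), q.coeff j * f (m - j) = 0)
    (h0 : ∀ i : ℕ, i < q.natDegree → f i = 0) (m : ℤ) : f m = 0 := by
  have hq0 : q ≠ 0 := by
    rintro rfl
    simp at hq
  have hlead : q.coeff q.natDegree ≠ 0 := by simpa using hq0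
  set d := q.natDegree
  have key : ∀ k : ℕ, ∀ m : ℤ, -(k : ℤ) ≤ m → m < d + k → f m = 0 := by
    intro k
    induction k with
    | zero =>
      intro m h1 h2
      lift m to ℕ using by simpa using h1
      exact h0 m (by simpa using h2)
    | succ k ih =>
      intro m h1 h2
      push_cast at h1 h2
      by_cases hm : m < -(k : ℤ)
      · have h3 := hf (m + d)
        rw [Finset.sum_range_succ, Finset.sum_eq_zero, zero_add, add_sub_cancel_right] at h3
        · exact (mul_eq_zero.1 h3).resolve_left hlead
        · intro j hj
          rw [Finset.mem_range] at hj
          rw [ih _ (by omega) (by omega), mul_zero]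
      · by_cases hm' : m < d + k
        · exact ih m (by omega) hm'
        · have h3 := hf m
          rw [Finset.sum_range_succ', Finset.sum_eq_zero, zero_add, Nat.cast_zero, sub_zero] at h3
          · exact (mul_eq_zero.1 h3).resolve_left hq
          · intro j hj
            rw [Finset.mem_range] at hj
            rw [ih _ (by push_cast; omega) (by push_cast; omega), mul_zero]
  exact key (m.natAbs + 1) m (by omega) (by omega)

/-- The recurrences do not depend on the coloring, so they hold for the difference of two. If the
two agree on the box, horizontal propagation gives strips and vertical propagation the plane. -/
theorem Admissible.finite_colorings (h : Admissible D B t₀) :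
    {c : ℤ × ℤ → Fin n | IsColoring D B c}.Finite := by
  obtain ⟨p, hp, hpc⟩ := h.exists_recurrence (1, 0)
  obtain ⟨q, hq, hqc⟩ := h.exists_recurrence (0, 1)
  refine Set.Finite.of_finite_image (f := fun c (i : Fin p.natDegree × Fin q.natDegree) =>
    c ((i.1 : ℕ), (i.2 : ℕ))) (Set.toFinite _) ?_
  intro c hc c' hc' hcc
  have hbox : ∀ i j : ℕ, i < p.natDegree → j < q.natDegree → c (i, j) = c' (i, j) :=
    fun i j hi hj => congrFun hcc (⟨i, hi⟩, ⟨j, hj⟩)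
  set f : ℤ × ℤ → ℂ := fun u => ((c u : ℕ) : ℂ) - ((c' u : ℕ) : ℂ) with hf
  have hrow : ∀ (i : ℤ) (j : ℕ), j < q.natDegree → f (i, j) = 0 := by
    intro i j hj
    refine eq_zero_of_recurrence hp (fun i => f (i, j)) (fun m => ?_) (fun i hi => ?_) i
    · have h1 := hpc c hc (m, j)
      have h2 := hpc c' hc' (m, j)
      simp only [Prod.smul_mk, nsmul_eq_mul, mul_one, mul_zero, Prod.mk_sub_mk, sub_zero] at h1 h2
      simp only [hf, mul_sub, Finset.sum_sub_distrib, h1, h2, sub_zero]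
    · simp only [hf, hbox i j hi hj, sub_self]
  have hall : ∀ i j : ℤ, f (i, j) = 0 := by
    intro i j
    refine eq_zero_of_recurrence hq (fun j => f (i, j)) (fun m => ?_) (fun j hj => hrow i j hj) j
    have h1 := hqc c hc (i, m)
    have h2 := hqc c' hc' (i, m)
    simp only [Prod.smul_mk, nsmul_eq_mul, mul_one, mul_zero, Prod.mk_sub_mk, sub_zero] at h1 h2
    simp only [hf, mul_sub, Finset.sum_sub_distrib, h1, h2, sub_zero]
  funext u
  have := hall u.1 u.2
  simp only [hf, sub_eq_zero, Nat.cast_inj] at this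
  exact Fin.ext this

end PerfectColoring

/-! ### Common periods and their finite certificates. -/

namespace PerfectColoring

open Filter

/-- The digit of weight `n ^ m` of `k`, read as the color of the cell with index `m`. -/
def digit (n k m : ℕ) : ℕ := k / n ^ m % n

lemma exists_digit_eq {n : ℕ} (M : ℕ) (g : Fin M → Fin n) :
    ∃ k < n ^ M, ∀ m : Fin M, digit n k m = g m := by
  refine ⟨finFunctionFinEquiv g, (finFunctionFinEquiv g).2, fun m => ?_⟩
  conv_rhs => rw [← finFunctionFinEquiv.symm_apply_apply g]
  rfl

lemma eq_of_digit_eq {n M k k' : ℕ} (hk : k < n ^ M) (hk' : k' < n ^ M)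
    (h : ∀ m < M, digit n k m = digit n k' m) : k = k' := by
  have : finFunctionFinEquiv.symm (⟨k, hk⟩ : Fin (n ^ M)) =
      finFunctionFinEquiv.symm (⟨k', hk'⟩ : Fin (n ^ M)) :=
    funext fun m => Fin.ext (h m m.2)
  exact congrArg Fin.val (finFunctionFinEquiv.symm.injective this)

/-- An enumeration of the cells. -/
def cell (m : ℕ) : ℤ × ℤ := (Denumerable.ofNat ℤ m.unpair.1, Denumerable.ofNat ℤ m.unpair.2)

/-- The position of a cell in the enumeration `cell`. -/
def index (u : ℤ × ℤ) : ℕ := Nat.pair (Encodable.encode u.1) (Encodable.encode u.2)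

lemma cell_index (u : ℤ × ℤ) : cell (index u) = u := by
  simp only [cell, index, Nat.unpair_pair]
  exact Prod.ext (Denumerable.ofNat_encode u.1) (Denumerable.ofNat_encode u.2)

lemma index_cell (m : ℕ) : index (cell m) = m := by
  simp only [cell, index]
  conv_rhs => rw [← Nat.pair_unpair m]
  exact congrArg₂ Nat.pair (Denumerable.encode_ofNat _) (Denumerable.encode_ofNat _)

/-- Removal of duplicates. -/
def distinct (L : List (ℤ × ℤ)) : List (ℤ × ℤ) := L.foldr List.insert []

lemma toFinset_distinct (L : List (ℤ × ℤ)) : (distinct L).toFinset = L.toFinset := by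
  induction L with
  | nil => rfl
  | cons a L ih =>
    ext d
    have h1 : d ∈ distinct L ↔ d ∈ L := by
      rw [← List.mem_toFinset, ih, List.mem_toFinset]
    rw [List.mem_toFinset, List.mem_toFinset, List.mem_cons, ← h1]
    exact List.mem_insert_iff

lemma nodup_distinct (L : List (ℤ × ℤ)) : (distinct L).Nodup := by
  induction L with
  | nil => exact List.nodup_nil
  | cons a L ih => exact ih.insert

/-- The entry of a matrix given by the list of its rows. -/
def entry (R : List (List ℕ)) (i j : ℕ) : ℕ := (R.getD i []).getD j 0

/-- The condition on the neighborhood of the cell `u` in the configuration `f`. -/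
def CellOk (L : List (ℤ × ℤ)) (R : List (List ℕ)) (f : ℤ × ℤ → ℕ) (u : ℤ × ℤ) : Prop :=
  ∀ b < R.length, ((distinct L).filter fun d => f (u + d) = b).length = entry R b (f u)

variable {n : ℕ} {D : Finset (ℤ × ℤ)} {B : Matrix (Fin n) (Fin n) ℕ} {t₀ : ℤ}
  {L : List (ℤ × ℤ)}

lemma length_rows (B : Matrix (Fin n) (Fin n) ℕ) : (rows B).length = n := by simp [rows]

lemma entry_rows (B : Matrix (Fin n) (Fin n) ℕ) (i j : Fin n) : entry (rows B) i j = B i j := by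
  simp [entry, rows, List.getD_eq_getElem?_getD]

lemma length_filter_distinct (hL : L.toFinset = D) (p : ℤ × ℤ → Prop) [DecidablePred p] :
    ((distinct L).filter fun d => p d).length = (D.filter p).card := by
  rw [← List.toFinset_card_of_nodup ((nodup_distinct L).filter _), List.toFinset_filter,
    toFinset_distinct, hL]
  simp

lemma CellOk.congr {R : List (List ℕ)} {f g : ℤ × ℤ → ℕ} {u w : ℤ × ℤ} (h : CellOk L R f u)
    (hu : f u = g w) (hd : ∀ d ∈ L, f (u + d) = g (w + d)) : CellOk L R g w := by
  intro b hb
  rw [← hu, ← h b hb]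
  congr 1
  refine List.filter_congr fun d hd' => ?_
  have : d ∈ L := by
    rwa [← List.mem_toFinset, ← toFinset_distinct, List.mem_toFinset]
  rw [hd d this]

lemma isColoring_iff (hL : L.toFinset = D) {c : ℤ × ℤ → Fin n} :
    IsColoring D B c ↔ ∀ u, CellOk L (rows B) (fun u => (c u : ℕ)) u := by
  constructor
  · intro h u b hb
    rw [length_rows] at hb
    rw [length_filter_distinct hL (fun d => (c (u + d) : ℕ) = b)]
    have h1 := h ⟨b, hb⟩ (c u) u rfl
    rw [← entry_rows B] at h1
    rw [← h1]
    congr 1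
    ext d
    simp [Fin.ext_iff]
  · rintro h i j u rfl
    have h1 := h u i (by rw [length_rows]; exact i.2)
    rw [length_filter_distinct hL (fun d => (c (u + d) : ℕ) = i), entry_rows] at h1
    rw [← h1]
    congr 1
    ext d
    simp [Fin.ext_iff]

lemma IsColoring.translate {c : ℤ × ℤ → Fin n} (h : IsColoring D B c) (w : ℤ × ℤ) :
    IsColoring D B (fun u => c (u + w)) := by
  intro i j u hu
  rw [← h i j (u + w) hu]
  congr 1
  ext d
  simp [add_right_comm]

/-- Translation by a vector permutes the colorings. -/
def translatePerm (D : Finset (ℤ × ℤ)) (B : Matrix (Fin n) (Fin n) ℕ) :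
    Multiplicative (ℤ × ℤ) →* Equiv.Perm {c : ℤ × ℤ → Fin n | IsColoring D B c} where
  toFun w :=
    { toFun := fun c => ⟨fun u => c.1 (u + w.toAdd), c.2.translate _⟩
      invFun := fun c => ⟨fun u => c.1 (u + -w.toAdd), c.2.translate _⟩
      left_inv := fun c => by ext; simp
      right_inv := fun c => by ext; simp }
  map_one' := by ext; simp
  map_mul' v w := by
    refine Equiv.ext fun c => Subtype.ext (funext fun u => ?_)
    exact congrArg c.1 (add_assoc u v.toAdd w.toAdd).symm

/-- The colorings have a common period in all directions. -/
lemma Admissible.exists_period (h : Admissible D B t₀) : ∃ P : ℕ, 0 < P ∧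
    ∀ c, IsColoring D B c → ∀ u w : ℤ × ℤ, c (u + P • w) = c u := by
  have := h.finite_colorings.to_subtype
  -- In a finite group, every element raised to the order of the group is trivial.
  refine ⟨Nat.card (Equiv.Perm {c : ℤ × ℤ → Fin n | IsColoring D B c}), Nat.card_pos,
    fun c hc u w => ?_⟩
  have h1 : translatePerm D B (Multiplicative.ofAdd
      (Nat.card (Equiv.Perm {c : ℤ × ℤ → Fin n | IsColoring D B c}) • w)) = 1 := by
    rw [ofAdd_nsmul, map_pow, pow_card_eq_one']
  have h2 := congrArg (fun c : {c : ℤ × ℤ → Fin n | IsColoring D B c} => c.1 u)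
    (Equiv.ext_iff.1 h1 ⟨c, hc⟩)
  exact h2

/-- The pattern coded by `k` on the first `M` cells satisfies all the conditions on cells whose
neighborhood is contained in the first `M` cells. -/
def LocallyOk (L : List (ℤ × ℤ)) (R : List (List ℕ)) (M k : ℕ) : Prop :=
  ∀ m < M, (∀ d ∈ L, index (cell m + d) < M) →
    CellOk L R (fun u => digit R.length k (index u)) (cell m)

/-- The local conditions on the first `M` cells imply that the colors of the cells
`(0, 0)`, `(P, 0)` and `(0, P)` are equal. -/
def IsCertificate (L : List (ℤ × ℤ)) (R : List (List ℕ)) (P M : ℕ) : Prop :=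
  (index (0, 0) < M ∧ index ((P : ℤ), 0) < M ∧ index (0, (P : ℤ)) < M) ∧
    ∀ k < R.length ^ M, LocallyOk L R M k →
      digit R.length k (index (0, 0)) = digit R.length k (index ((P : ℤ), 0)) ∧
      digit R.length k (index (0, 0)) = digit R.length k (index (0, (P : ℤ)))

/-- The certificate is applied to the first `M` cells of the coloring translated by `u`, which moves
`u` to the origin. -/
lemma IsCertificate.periodic {P M : ℕ} (hL : L.toFinset = D)
    (h : IsCertificate L (rows B) P M) {c : ℤ × ℤ → Fin n} (hc : IsColoring D B c) (u : ℤ × ℤ) :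
    c (u + ((P : ℤ), 0)) = c u ∧ c (u + (0, (P : ℤ))) = c u := by
  obtain ⟨⟨h0, h1, h2⟩, h3⟩ := h
  rw [length_rows] at h3
  obtain ⟨k, hk, hkd⟩ := exists_digit_eq M (fun m : Fin M => c (cell m + u))
  have hkd' : ∀ w, index w < M → digit n k (index w) = c (w + u) := fun w hw => by
    rw [hkd ⟨index w, hw⟩, cell_index]
  have h4 := h3 k hk (by
    intro m hm hd
    refine ((isColoring_iff hL).1 (hc.translate u) (cell m)).congr ?_ fun d hd' => ?_
    · rw [length_rows, hkd' _ (by rwa [index_cell])]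
    · rw [length_rows, hkd' _ (hd d hd')])
  rw [hkd' _ h0, hkd' _ h1, hkd' _ h2] at h4
  have h5 : ((0, 0) : ℤ × ℤ) + u = u := zero_add u
  rw [h5, add_comm _ u, add_comm _ u] at h4
  exact ⟨Fin.ext h4.1.symm, Fin.ext h4.2.symm⟩

/-- Compactness: counterexamples on ever larger regions would have a limit that is a coloring
without period `P`. -/
lemma exists_isCertificate (hL : L.toFinset = D) {P : ℕ}
    (hP : ∀ c, IsColoring D B c → ∀ u w : ℤ × ℤ, c (u + P • w) = c u) :
    ∃ M, IsCertificate L (rows B) P M := by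
  by_contra! hne
  set M₀ := index (0, 0) + index ((P : ℤ), 0) + index (0, (P : ℤ)) + 1 with hM₀
  have hbad : ∀ M, ∃ k, M₀ ≤ M → k < n ^ M ∧ LocallyOk L (rows B) M k ∧
      ¬ (digit n k (index (0, 0)) = digit n k (index ((P : ℤ), 0)) ∧
      digit n k (index (0, 0)) = digit n k (index (0, (P : ℤ)))) := by
    intro M
    by_cases hM : M₀ ≤ M
    · have h1 := hne M
      rw [IsCertificate, not_and] at h1
      have h2 := h1 ⟨by omega, by omega, by omega⟩
      push Not at h2
      rw [length_rows] at h2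
      obtain ⟨k, hk, hk1, hk2⟩ := h2
      exact ⟨k, fun _ => ⟨hk, hk1, fun h => hk2 h.1 h.2⟩⟩
    · exact ⟨0, fun h => absurd h hM⟩
  choose k hk using hbad
  have hn : 0 < n := by
    by_contra h0
    have h1 := (hk M₀ le_rfl).1
    rw [Nat.eq_zero_of_not_pos h0, zero_pow (by omega)] at h1
    exact absurd h1 (Nat.not_lt_zero _)
  -- The limit color of a cell along `U` exists because there are finitely many colors. Each local
  -- condition involves finitely many cells, so it agrees with that of some pattern of large size.
  let U : Ultrafilter ℕ := hyperfilter ℕ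
  have hU : ∀ m, ∀ᶠ M in (U : Filter ℕ), m ≤ M := fun m =>
    (Nat.hyperfilter_le_atTop (eventually_ge_atTop m))
  have hlim : ∀ u, ∃ i : Fin n, ∀ᶠ M in (U : Filter ℕ), digit n (k M) (index u) = i := by
    intro u
    obtain ⟨i, hi⟩ := (U.map fun M => (⟨digit n (k M) (index u), Nat.mod_lt _ hn⟩ : Fin n)
      ).eq_pure_of_finite
    refine ⟨i, ?_⟩
    have h1 : {i} ∈ U.map fun M => (⟨digit n (k M) (index u), Nat.mod_lt _ hn⟩ : Fin n) := by
      rw [hi]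
      exact rfl
    rw [Ultrafilter.mem_map] at h1
    filter_upwards [h1] with M hM
    exact congrArg Fin.val hM
  choose c hc using hlim
  have hcol : IsColoring D B c := by
    refine (isColoring_iff hL).2 fun u => ?_
    have h1 : ∀ᶠ M in (U : Filter ℕ), ∀ d ∈ L.toFinset,
        digit n (k M) (index (u + d)) = c (u + d) ∧ index (u + d) + 1 ≤ M :=
      (Finset.eventually_all _).2 fun d _ => (hc _).and (hU _)
    obtain ⟨M, hM1, hM2, hM3, hM4⟩ :=
      (h1.and ((hc u).and ((hU (index u + 1)).and (hU M₀)))).exists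
    have h2 := (hk M hM4).2.1 (index u) hM3 (fun d hd => by
      rw [cell_index]
      exact (hM1 d (List.mem_toFinset.2 hd)).2)
    rw [cell_index, length_rows] at h2
    exact h2.congr hM2 fun d hd => (hM1 d (List.mem_toFinset.2 hd)).1
  have h1 : c ((P : ℤ), 0) = c (0, 0) := by simpa using hP c hcol (0, 0) (1, 0)
  have h2 : c (0, (P : ℤ)) = c (0, 0) := by simpa using hP c hcol (0, 0) (0, 1)
  obtain ⟨M, hM1, hM2, hM3, hM4⟩ :=
    ((hc (0, 0)).and ((hc ((P : ℤ), 0)).and ((hc (0, (P : ℤ))).and (hU M₀)))).exists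
  refine (hk M hM4).2.2 ⟨?_, ?_⟩
  · rw [hM1, hM2, h1]
  · rw [hM1, hM3, h2]

/-! ### Enumeration of the periodic colorings. -/

/-- The position, in the enumeration of `[0, P) × [0, P)` row by row, of the representative of the
cell `u` modulo `P`. -/
def torusIndex (P : ℕ) (u : ℤ × ℤ) : ℕ :=
  (u.1 % (P : ℤ)).toNat * P + (u.2 % (P : ℤ)).toNat

/-- The digits of `k`, repeated with period `P` in both directions, form a coloring. -/
def TorusOk (L : List (ℤ × ℤ)) (R : List (List ℕ)) (P k : ℕ) : Prop :=
  ∀ i < P, ∀ j < P, CellOk L R (fun u => digit R.length k (torusIndex P u)) ((i : ℤ), (j : ℤ))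

/-- The table of the digits of `k`. -/
def digitTable (n P k : ℕ) : List (List ℕ) :=
  (List.range P).map fun i => (List.range P).map fun j => digit n k (i * P + j)

open Classical in
/-- The tables of all the `P`-periodic colorings. -/
noncomputable def periodicTables (L : List (ℤ × ℤ)) (R : List (List ℕ)) (P : ℕ) :
    List (List (List ℕ)) :=
  ((List.range (R.length ^ (P * P))).filter fun k => TorusOk L R P k).map (digitTable R.length P)

/-- The `P`-periodic configuration given by the digits of `k`. -/
def digitConfig (hn : 0 < n) (P k : ℕ) (u : ℤ × ℤ) : Fin n :=
  ⟨digit n k (torusIndex P u), Nat.mod_lt _ hn⟩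

lemma torusIndex_add (P : ℕ) (u w : ℤ × ℤ) : torusIndex P (u + P • w) = torusIndex P u := by
  simp [torusIndex]

lemma torusIndex_natCast {P i j : ℕ} (hi : i < P) (hj : j < P) :
    torusIndex P ((i : ℤ), (j : ℤ)) = i * P + j := by
  simp only [torusIndex]
  norm_cast
  rw [Nat.mod_eq_of_lt hi, Nat.mod_eq_of_lt hj]

lemma exists_eq_natCast_add {P : ℕ} (hP : 0 < P) (u : ℤ × ℤ) :
    ∃ i < P, ∃ j < P, ∃ w, u = ((i : ℤ), (j : ℤ)) + P • w := by
  have hP' : (0 : ℤ) < P := by exact_mod_cast hP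
  have h1 := Int.emod_nonneg u.1 hP'.ne'
  have h2 := Int.emod_nonneg u.2 hP'.ne'
  have h3 := Int.emod_lt_of_pos u.1 hP'
  have h4 := Int.emod_lt_of_pos u.2 hP'
  refine ⟨(u.1 % P).toNat, by omega, (u.2 % P).toNat, by omega, (u.1 / P, u.2 / P), ?_⟩
  ext
  · simp [Int.toNat_of_nonneg h1, Int.emod_add_mul_ediv]
  · simp [Int.toNat_of_nonneg h2, Int.emod_add_mul_ediv]

lemma isColoring_digitConfig_iff (hL : L.toFinset = D) (hn : 0 < n) {P : ℕ} (hP : 0 < P) (k : ℕ) :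
    IsColoring D B (digitConfig hn P k) ↔ TorusOk L (rows B) P k := by
  rw [isColoring_iff hL, TorusOk, length_rows]
  refine ⟨fun h i _ j _ => h _, fun h u => ?_⟩
  obtain ⟨i, hi, j, hj, w, rfl⟩ := exists_eq_natCast_add hP u
  refine (h i hi j hj).congr ?_ fun d _ => ?_
  · simp only [digitConfig, torusIndex_add]
  · simp only [digitConfig, add_right_comm _ (P • w), torusIndex_add]

lemma exists_digitConfig_eq (hn : 0 < n) {P : ℕ} (hP : 0 < P) {c : ℤ × ℤ → Fin n}
    (hc : ∀ u w : ℤ × ℤ, c (u + P • w) = c u) : ∃ k < n ^ (P * P), digitConfig hn P k = c := by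
  obtain ⟨k, hk, hkd⟩ := exists_digit_eq (P * P)
    (fun m => c (((m / P : ℕ) : ℤ), ((m % P : ℕ) : ℤ)))
  refine ⟨k, hk, funext fun u => ?_⟩
  obtain ⟨i, hi, j, hj, w, rfl⟩ := exists_eq_natCast_add hP u
  apply Fin.ext
  have hlt : i * P + j < P * P := by nlinarith
  rw [hc, digitConfig]
  simp only [torusIndex_add]
  rw [torusIndex_natCast hi hj, hkd ⟨_, hlt⟩]
  simp only [mul_comm i P]
  rw [Nat.mul_add_div hP, Nat.div_eq_of_lt hj, Nat.mul_add_mod, Nat.mod_eq_of_lt hj, add_zero]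

lemma digitConfig_injOn (hn : 0 < n) {P : ℕ} (hP : 0 < P) :
    Set.InjOn (digitConfig hn P) {k | k < n ^ (P * P)} := by
  intro k hk k' hk' h
  refine eq_of_digit_eq hk hk' fun m hm => ?_
  have h1 := congrArg Fin.val (congrFun h (((m / P : ℕ) : ℤ), ((m % P : ℕ) : ℤ)))
  simp only [digitConfig] at h1
  rwa [torusIndex_natCast (Nat.div_lt_of_lt_mul hm) (Nat.mod_lt _ hP), mul_comm,
    Nat.div_add_mod] at h1

lemma isTableOf_digitTable (hn : 0 < n) {P : ℕ} (hP : 0 < P) (k : ℕ) :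
    IsTableOf (digitTable n P k) (digitConfig hn P k) := by
  refine ⟨P, P, hP, hP, fun u => ?_, fun u => ?_, ?_⟩
  · rw [show ((P : ℤ), (0 : ℤ)) = P • (1, 0) by simp]
    simp only [digitConfig, torusIndex_add]
  · rw [show ((0 : ℤ), (P : ℤ)) = P • (0, 1) by simp]
    simp only [digitConfig, torusIndex_add]
  · refine List.ext_getElem (by simp [digitTable]) fun i h1 h2 => ?_
    simp only [digitTable, List.length_map, List.length_range] at h1
    refine List.ext_getElem (by simp [digitTable]) fun j h3 h4 => ?_
    simp only [digitTable, List.getElem_map, List.length_map, List.length_range] at h3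
    simp [digitTable, digitConfig, torusIndex_natCast h1 h3]

lemma listsAllColorings_periodicTables (hL : L.toFinset = D) {P : ℕ} (hP : 0 < P)
    (hper : ∀ c, IsColoring D B c → ∀ u w : ℤ × ℤ, c (u + P • w) = c u) :
    ListsAllColorings D B (periodicTables L (rows B) P) := by
  classical
  -- Without colors there is no coloring, and `0 ^ (P * P) = 0` leaves no candidates.
  rcases Nat.eq_zero_or_pos n with rfl | hn
  · refine ⟨[], List.nodup_nil, fun c => (c 0).elim0, ?_⟩
    rw [periodicTables, length_rows, zero_pow (by positivity)]
    exact List.Forall₂.nil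
  · set ks := (List.range (n ^ (P * P))).filter fun k => TorusOk L (rows B) P k with hks
    have hmem : ∀ {k}, k ∈ ks ↔ k < n ^ (P * P) ∧ TorusOk L (rows B) P k := by
      intro k
      simp [hks]
    refine ⟨ks.map (digitConfig hn P), ?_, fun c => ?_, ?_⟩
    · refine List.Nodup.map_on (fun k hk k' hk' h => ?_) (List.nodup_range.filter _)
      exact digitConfig_injOn hn hP (hmem.1 hk).1 (hmem.1 hk').1 h
    · rw [List.mem_map]
      constructor
      · rintro ⟨k, hk, rfl⟩
        exact (isColoring_digitConfig_iff hL hn hP k).2 (hmem.1 hk).2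
      · intro hc
        obtain ⟨k, hk, rfl⟩ := exists_digitConfig_eq hn hP (hper c hc)
        exact ⟨k, hmem.2 ⟨hk, (isColoring_digitConfig_iff hL hn hP k).1 hc⟩, rfl⟩
    · rw [periodicTables, length_rows, List.forall₂_map_left_iff, List.forall₂_map_right_iff,
        List.forall₂_same]
      exact fun k _ => isTableOf_digitTable hn hP k

/-- Any certificate proves its own `P` to be a common period, so the output is correct whichever one
the search meets. -/
lemma IsCertificate.listsAllColorings {P M : ℕ} (hL : L.toFinset = D) (hP : 0 < P)
    (h : IsCertificate L (rows B) P M) : ListsAllColorings D B (periodicTables L (rows B) P) := by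
  refine listsAllColorings_periodicTables hL hP fun c hc u w => ?_
  have hx : ∀ u, c (u + P • (1, 0)) = c u := fun u => by
    simpa using (h.periodic hL hc u).1
  have hy : ∀ u, c (u + P • (0, 1)) = c u := fun u => by
    simpa using (h.periodic hL hc u).2
  have hz : ∀ e : ℤ × ℤ, (∀ u, c (u + P • e) = c u) → ∀ (m : ℤ) (u), c (u + m • P • e) = c u := by
    intro e he m
    induction m with
    | zero => simp
    | succ m ih =>
      intro u
      rw [add_smul, one_smul, ← add_assoc, he, ih]
    | pred m ih =>
      intro u
      rw [← he, sub_smul, one_smul, add_assoc, sub_add_cancel, ih]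
  have hw : P • w = w.1 • P • ((1, 0) : ℤ × ℤ) + w.2 • P • ((0, 1) : ℤ × ℤ) := by
    ext <;> simp [mul_comm]
  rw [hw, ← add_assoc, hz _ hy, hz _ hx]

end PerfectColoring

/-! ### Primitive recursiveness of the tests, and the search. -/

namespace PerfectColoring

open Encodable

lemma encode_natCast (a : ℕ) : encode (a : ℤ) = 2 * a := rfl

lemma encode_negSucc (a : ℕ) : encode (Int.negSucc a) = 2 * a + 1 := rfl

lemma primrec_toNat : Primrec Int.toNat := by
  have h : Primrec fun z : ℤ => if encode z % 2 = 0 then encode z / 2 else 0 :=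
    Primrec.ite (Primrec.eq.comp (Primrec.nat_mod.comp Primrec.encode (Primrec.const 2))
      (Primrec.const 0)) (Primrec.nat_div.comp Primrec.encode (Primrec.const 2)) (Primrec.const 0)
  refine h.of_eq fun z => ?_
  cases z with
  | ofNat a =>
    rw [Int.ofNat_eq_natCast, encode_natCast]
    simp
  | negSucc a =>
    rw [encode_negSucc, if_neg (by omega)]
    rfl

lemma primrec_toNat_neg : Primrec fun z : ℤ => (-z).toNat := by
  have h : Primrec fun z : ℤ => if encode z % 2 = 0 then 0 else encode z / 2 + 1 :=
    Primrec.ite (Primrec.eq.comp (Primrec.nat_mod.comp Primrec.encode (Primrec.const 2))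
      (Primrec.const 0)) (Primrec.const 0)
      (Primrec.succ.comp (Primrec.nat_div.comp Primrec.encode (Primrec.const 2)))
  refine h.of_eq fun z => ?_
  cases z with
  | ofNat a =>
    rw [Int.ofNat_eq_natCast, encode_natCast, if_pos (by omega)]
    omega
  | negSucc a =>
    rw [encode_negSucc, if_neg (by omega)]
    omega

lemma primrec_natCast_sub : Primrec₂ fun a b : ℕ => (a : ℤ) - b := by
  refine Primrec₂.encode_iff.1 ?_
  have h : Primrec₂ fun a b : ℕ => if b ≤ a then 2 * (a - b) else 2 * (b - a - 1) + 1 :=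
    Primrec.ite (Primrec.nat_le.comp Primrec.snd Primrec.fst)
      (Primrec.nat_double.comp (Primrec.nat_sub.comp Primrec.fst Primrec.snd))
      (Primrec.nat_double_succ.comp (Primrec.nat_sub.comp
        (Primrec.nat_sub.comp Primrec.snd Primrec.fst) (Primrec.const 1)))
  refine h.of_eq fun a b => ?_
  split_ifs with hab
  · rw [← Nat.cast_sub hab, encode_natCast]
  · rw [show (a : ℤ) - b = Int.negSucc (b - a - 1) by omega, encode_negSucc]

lemma primrec_natCast : Primrec fun a : ℕ => (a : ℤ) :=
  (primrec_natCast_sub.comp Primrec.id (Primrec.const 0)).of_eq fun a => by simp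

lemma primrec_int_add : Primrec₂ fun x y : ℤ => x + y := by
  have h : Primrec₂ fun x y : ℤ =>
      ((x.toNat + y.toNat : ℕ) : ℤ) - (((-x).toNat + (-y).toNat : ℕ) : ℤ) :=
    primrec_natCast_sub.comp
      (Primrec.nat_add.comp (primrec_toNat.comp Primrec.fst) (primrec_toNat.comp Primrec.snd))
      (Primrec.nat_add.comp (primrec_toNat_neg.comp Primrec.fst)
        (primrec_toNat_neg.comp Primrec.snd))
  exact h.of_eq fun x y => by omega

/-- Since `-1 ≡ p` modulo `p + 1`, the negative part of `z` may be replaced by `p` times its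
absolute value, which leaves natural numbers only. -/
lemma primrec_toNat_emod : Primrec₂ fun (z : ℤ) (p : ℕ) => (z % ((p + 1 : ℕ) : ℤ)).toNat := by
  have h : Primrec₂ fun (z : ℤ) (p : ℕ) => (z.toNat + (-z).toNat * p) % (p + 1) :=
    Primrec.nat_mod.comp
      (Primrec.nat_add.comp (primrec_toNat.comp Primrec.fst)
        (Primrec.nat_mul.comp (primrec_toNat_neg.comp Primrec.fst) Primrec.snd))
      (Primrec.succ.comp Primrec.snd)
  refine h.of_eq fun z p => ?_
  have h1 : z % ((p + 1 : ℕ) : ℤ) = (((z.toNat + (-z).toNat * p) % (p + 1) : ℕ) : ℤ) := by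
    rw [Int.natCast_mod]
    refine (Int.modEq_iff_dvd.2 ⟨((-z).toNat : ℤ), ?_⟩ : _ ≡ _ [ZMOD _])
    have h2 : z = (z.toNat : ℤ) - ((-z).toNat : ℤ) := by omega
    push_cast
    linear_combination -h2
  rw [h1, Int.toNat_natCast]

lemma primrec_pow : Primrec₂ fun a b : ℕ => a ^ b :=
  Primrec₂.unpaired'.1 Nat.Primrec.pow

lemma primrec_cell_add : Primrec₂ fun u v : ℤ × ℤ => u + v :=
  Primrec.pair
    (primrec_int_add.comp (Primrec.fst.comp Primrec.fst) (Primrec.fst.comp Primrec.snd))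
    (primrec_int_add.comp (Primrec.snd.comp Primrec.fst) (Primrec.snd.comp Primrec.snd))

lemma primrec_cell : Primrec cell :=
  Primrec.pair ((Primrec.ofNat ℤ).comp (Primrec.fst.comp Primrec.unpair))
    ((Primrec.ofNat ℤ).comp (Primrec.snd.comp Primrec.unpair))

lemma primrec_index : Primrec index :=
  Primrec₂.natPair.comp (Primrec.encode.comp Primrec.fst) (Primrec.encode.comp Primrec.snd)

lemma primrec_distinct : Primrec distinct := by
  have h : Primrec fun L : List (ℤ × ℤ) =>
      L.foldr (fun d l => if d ∈ l then l else d :: l) [] := by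
    refine Primrec.list_foldr Primrec.id (Primrec.const ([] : List (ℤ × ℤ)))
      (h := fun _ p => if p.1 ∈ p.2 then p.2 else p.1 :: p.2) ?_
    have h1 : Primrec fun q : List (ℤ × ℤ) × (ℤ × ℤ) × List (ℤ × ℤ) => q.2.1 :=
      Primrec.fst.comp Primrec.snd
    have h2 : Primrec fun q : List (ℤ × ℤ) × (ℤ × ℤ) × List (ℤ × ℤ) => q.2.2 :=
      Primrec.snd.comp Primrec.snd
    exact Primrec.ite ((Primrec.eq.exists_mem_list.comp h2 h1).of_eq (by simp)) h2
      (Primrec.list_cons.comp h1 h2)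
  refine h.of_eq fun L => ?_
  rw [distinct]
  congr 1
  funext d l
  split_ifs with hd
  · rw [List.insert_of_mem hd]
  · rw [List.insert_of_not_mem hd]

lemma primrec_entry {α : Type*} [Primcodable α] {R : α → List (List ℕ)} {i j : α → ℕ}
    (hR : Primrec R) (hi : Primrec i) (hj : Primrec j) :
    Primrec fun a => entry (R a) (i a) (j a) :=
  (Primrec.list_getD 0).comp ((Primrec.list_getD []).comp hR hi) hj

lemma primrec_digit {α : Type*} [Primcodable α] {n k m : α → ℕ} (hn : Primrec n) (hk : Primrec k)
    (hm : Primrec m) : Primrec fun a => digit (n a) (k a) (m a) :=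
  Primrec.nat_mod.comp (Primrec.nat_div.comp hk (primrec_pow.comp hn hm)) hn

lemma primrecPred_forall_lt {α : Type*} [Primcodable α] {f : α → ℕ} {p : α → ℕ → Prop}
    (hf : Primrec f) (hp : PrimrecRel p) : PrimrecPred fun a => ∀ x < f a, p a x :=
  (hp.swap.forall_mem_list.comp (Primrec.list_range.comp hf) Primrec.id).of_eq (by simp)

lemma primrecPred_imp {α : Type*} [Primcodable α] {p q : α → Prop} (hp : PrimrecPred p)
    (hq : PrimrecPred q) : PrimrecPred fun a => p a → q a :=
  (hp.not.or hq).of_eq fun _ => imp_iff_not_or.symm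

lemma primrecPred_cellOk {α : Type*} [Primcodable α] {L : α → List (ℤ × ℤ)}
    {R : α → List (List ℕ)} {f : α → ℤ × ℤ → ℕ} {u : α → ℤ × ℤ} (hL : Primrec L) (hR : Primrec R)
    (hf : Primrec₂ f) (hu : Primrec u) : PrimrecPred fun a => CellOk (L a) (R a) (f a) (u a) := by
  refine primrecPred_forall_lt (Primrec.list_length.comp hR) ?_
  have h1 : PrimrecRel fun (d : ℤ × ℤ) (q : α × ℕ) => f q.1 (u q.1 + d) = q.2 :=
    Primrec.eq.comp (hf.comp (Primrec.fst.comp Primrec.snd)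
      (primrec_cell_add.comp (hu.comp (Primrec.fst.comp Primrec.snd)) Primrec.fst))
      (Primrec.snd.comp Primrec.snd)
  have h2 : Primrec fun q : α × ℕ =>
      ((distinct (L q.1)).filter fun d => f q.1 (u q.1 + d) = q.2).length :=
    Primrec.list_length.comp
      (h1.listFilter.comp (primrec_distinct.comp (hL.comp Primrec.fst)) Primrec.id)
  exact Primrec.eq.comp h2 (primrec_entry (hR.comp Primrec.fst) Primrec.snd
    (hf.comp Primrec.fst (hu.comp Primrec.fst)))

lemma primrecPred_locallyOk {α : Type*} [Primcodable α] {L : α → List (ℤ × ℤ)}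
    {R : α → List (List ℕ)} {M k : α → ℕ} (hL : Primrec L) (hR : Primrec R)
    (hM : Primrec M) (hk : Primrec k) :
    PrimrecPred fun a => LocallyOk (L a) (R a) (M a) (k a) := by
  refine primrecPred_forall_lt hM (primrecPred_imp (α := α × ℕ) ?_ ?_)
  · have h1 : PrimrecRel fun (d : ℤ × ℤ) (q : α × ℕ) => index (cell q.2 + d) < M q.1 :=
      Primrec.nat_lt.comp (primrec_index.comp (primrec_cell_add.comp
        (primrec_cell.comp (Primrec.snd.comp Primrec.snd)) Primrec.fst))
        (hM.comp (Primrec.fst.comp Primrec.snd))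
    exact h1.forall_mem_list.comp (hL.comp Primrec.fst) Primrec.id
  · refine primrecPred_cellOk (hL.comp Primrec.fst) (hR.comp Primrec.fst) ?_
      (primrec_cell.comp Primrec.snd)
    exact primrec_digit (Primrec.list_length.comp (hR.comp (Primrec.fst.comp Primrec.fst)))
      (hk.comp (Primrec.fst.comp Primrec.fst)) (primrec_index.comp Primrec.snd)

lemma primrecPred_isCertificate {α : Type*} [Primcodable α] {L : α → List (ℤ × ℤ)}
    {R : α → List (List ℕ)} {P M : α → ℕ} (hL : Primrec L) (hR : Primrec R)
    (hP : Primrec P) (hM : Primrec M) :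
    PrimrecPred fun a => IsCertificate (L a) (R a) (P a) (M a) := by
  have hn : Primrec fun a => (R a).length := Primrec.list_length.comp hR
  have h0 : Primrec fun _ : α => index (0, 0) := Primrec.const _
  have h1 : Primrec fun a => index ((P a : ℤ), 0) :=
    primrec_index.comp (Primrec.pair (primrec_natCast.comp hP) (Primrec.const 0))
  have h2 : Primrec fun a => index (0, (P a : ℤ)) :=
    primrec_index.comp (Primrec.pair (Primrec.const 0) (primrec_natCast.comp hP))
  refine PrimrecPred.and ((Primrec.nat_lt.comp h0 hM).and
    ((Primrec.nat_lt.comp h1 hM).and (Primrec.nat_lt.comp h2 hM))) ?_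
  refine primrecPred_forall_lt (primrec_pow.comp hn hM) (primrecPred_imp (α := α × ℕ) ?_ ?_)
  · exact primrecPred_locallyOk (hL.comp Primrec.fst) (hR.comp Primrec.fst) (hM.comp Primrec.fst)
      Primrec.snd
  · have hd : ∀ {m : α → ℕ}, Primrec m →
        Primrec fun q : α × ℕ => digit (R q.1).length q.2 (m q.1) := fun hm =>
      primrec_digit (hn.comp Primrec.fst) Primrec.snd (hm.comp Primrec.fst)
    exact (Primrec.eq.comp (hd h0) (hd h1)).and (Primrec.eq.comp (hd h0) (hd h2))

lemma primrec_torusIndex : Primrec₂ fun (p : ℕ) (u : ℤ × ℤ) => torusIndex (p + 1) u :=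
  Primrec.nat_add.comp
    (Primrec.nat_mul.comp
      (primrec_toNat_emod.comp (Primrec.fst.comp Primrec.snd) Primrec.fst)
      (Primrec.succ.comp Primrec.fst))
    (primrec_toNat_emod.comp (Primrec.snd.comp Primrec.snd) Primrec.fst)

lemma primrecPred_torusOk {α : Type*} [Primcodable α] {L : α → List (ℤ × ℤ)}
    {R : α → List (List ℕ)} {p k : α → ℕ} (hL : Primrec L) (hR : Primrec R)
    (hp : Primrec p) (hk : Primrec k) :
    PrimrecPred fun a => TorusOk (L a) (R a) (p a + 1) (k a) := by
  refine primrecPred_forall_lt (Primrec.succ.comp hp) (primrecPred_forall_lt (α := α × ℕ)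
    (Primrec.succ.comp (hp.comp Primrec.fst)) ?_)
  have h1 : Primrec fun q : (α × ℕ) × ℕ => q.1.1 := Primrec.fst.comp Primrec.fst
  refine primrecPred_cellOk (α := (α × ℕ) × ℕ) (hL.comp h1) (hR.comp h1)
    (f := fun q u => digit (R q.1.1).length (k q.1.1) (torusIndex (p q.1.1 + 1) u)) ?_
    (Primrec.pair (primrec_natCast.comp (Primrec.snd.comp Primrec.fst))
      (primrec_natCast.comp Primrec.snd))
  exact primrec_digit (Primrec.list_length.comp (hR.comp (h1.comp Primrec.fst)))
    (hk.comp (h1.comp Primrec.fst))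
    (primrec_torusIndex.comp (hp.comp (h1.comp Primrec.fst)) Primrec.snd)

lemma primrec_digitTable {α : Type*} [Primcodable α] {n P k : α → ℕ} (hn : Primrec n)
    (hP : Primrec P) (hk : Primrec k) : Primrec fun a => digitTable (n a) (P a) (k a) := by
  have h1 : Primrec fun q : (α × ℕ) × ℕ => q.1.1 := Primrec.fst.comp Primrec.fst
  refine Primrec.list_map (Primrec.list_range.comp hP)
    (g := fun a i => (List.range (P a)).map fun j => digit (n a) (k a) (i * P a + j)) ?_
  refine Primrec.list_map (α := α × ℕ) (Primrec.list_range.comp (hP.comp Primrec.fst))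
    (g := fun q j => digit (n q.1) (k q.1) (q.2 * P q.1 + j)) ?_
  exact primrec_digit (hn.comp h1) (hk.comp h1) (Primrec.nat_add.comp
    (Primrec.nat_mul.comp (Primrec.snd.comp Primrec.fst) (hP.comp h1)) Primrec.snd)

lemma primrec_periodicTables {α : Type*} [Primcodable α] {L : α → List (ℤ × ℤ)}
    {R : α → List (List ℕ)} {p : α → ℕ} (hL : Primrec L) (hR : Primrec R) (hp : Primrec p) :
    Primrec fun a => periodicTables (L a) (R a) (p a + 1) := by
  classical
  have hn : Primrec fun a => (R a).length := Primrec.list_length.comp hR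
  have hP : Primrec fun a => p a + 1 := Primrec.succ.comp hp
  have h1 : PrimrecRel fun (k : ℕ) (a : α) => TorusOk (L a) (R a) (p a + 1) k :=
    primrecPred_torusOk (α := ℕ × α) (hL.comp Primrec.snd) (hR.comp Primrec.snd)
      (hp.comp Primrec.snd) Primrec.fst
  refine Primrec.list_map ((h1.listFilter.comp (Primrec.list_range.comp
    (primrec_pow.comp hn (Primrec.nat_mul.comp hP hP))) Primrec.id).of_eq fun a => ?_)
    (primrec_digitTable (hn.comp Primrec.fst) (hP.comp Primrec.fst) Primrec.snd)
  rfl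

open Classical in
/-- The algorithm: search for a certificate, then list the tables of the periodic colorings. -/
noncomputable def construct (x : Input) : Part (List (List (List ℕ))) :=
  (Nat.rfind fun N => (Part.some
    (decide (IsCertificate x.1 x.2.1 (N.unpair.1 + 1) N.unpair.2)) : Part Bool)).map
      fun N => periodicTables x.1 x.2.1 (N.unpair.1 + 1)

lemma partrec_construct : Partrec construct := by
  classical
  have hL : Primrec fun q : Input × ℕ => q.1.1 := Primrec.fst.comp Primrec.fst
  have hR : Primrec fun q : Input × ℕ => q.1.2.1 :=
    Primrec.fst.comp (Primrec.snd.comp Primrec.fst)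
  have hp : Primrec fun q : Input × ℕ => q.2.unpair.1 :=
    Primrec.fst.comp (Primrec.unpair.comp Primrec.snd)
  have hM : Primrec fun q : Input × ℕ => q.2.unpair.2 :=
    Primrec.snd.comp (Primrec.unpair.comp Primrec.snd)
  have h1 := (primrecPred_isCertificate hL hR (Primrec.succ.comp hp) hM).decide
  have h2 : Computable₂ fun (x : Input) (N : ℕ) =>
      decide (IsCertificate x.1 x.2.1 (N.unpair.1 + 1) N.unpair.2) :=
    Primrec.to_comp h1
  have h3 : Computable₂ fun (x : Input) (N : ℕ) =>
      periodicTables x.1 x.2.1 (N.unpair.1 + 1) :=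
    Primrec.to_comp (primrec_periodicTables hL hR hp)
  exact (Partrec.rfind h2.partrec₂).map h3

lemma Admissible.exists_mem_construct {n : ℕ} {D : Finset (ℤ × ℤ)}
    {B : Matrix (Fin n) (Fin n) ℕ} {t₀ : ℤ} (h : Admissible D B t₀) {L : List (ℤ × ℤ)}
    (hL : L.toFinset = D) :
    ∃ out ∈ construct (L, rows B, t₀), ListsAllColorings D B out := by
  classical
  obtain ⟨P, hP, hper⟩ := h.exists_period
  obtain ⟨M, hM⟩ := exists_isCertificate hL hper
  -- The search tests `N.unpair.1 + 1` to keep periods positive, hence `P - 1` here. The known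
  -- certificate only ensures halting; the `N` found may be another.
  obtain ⟨N, hN, -⟩ := Nat.rfind_min' (m := Nat.pair (P - 1) M)
    (p := fun N => decide (IsCertificate L (rows B) (N.unpair.1 + 1) N.unpair.2)) (by
      simpa [Nat.sub_add_cancel hP] using hM)
  refine ⟨_, Part.mem_map _ hN, ?_⟩
  have h1 := Nat.rfind_spec hN
  have h2 : IsCertificate L (rows B) (N.unpair.1 + 1) N.unpair.2 := by simpa using h1
  exact h2.listsAllColorings hL (Nat.succ_pos _)

lemma ListsAllColorings.ne_nil_iff {n : ℕ} {D : Finset (ℤ × ℤ)}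
    {B : Matrix (Fin n) (Fin n) ℕ} {out : List (List (List ℕ))} (h : ListsAllColorings D B out) :
    out ≠ [] ↔ ∃ c : ℤ × ℤ → Fin n, IsColoring D B c := by
  obtain ⟨cs, -, hmem, hall⟩ := h
  have h1 : out = [] ↔ cs = [] := by
    rw [← List.length_eq_zero_iff, hall.length_eq, List.length_eq_zero_iff]
  rw [Ne, h1, ← Ne]
  exact ⟨fun hne => (List.exists_mem_of_ne_nil cs hne).imp fun c hc => (hmem c).1 hc,
    fun ⟨c, hc⟩ => List.ne_nil_of_mem ((hmem c).2 hc)⟩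

end PerfectColoring

theorem mainTheorem12 :
    -- there are only finitely many colorings
    (∀ (n : ℕ) (D : Finset (ℤ × ℤ)) (B : Matrix (Fin n) (Fin n) ℕ) (t₀ : ℤ),
      PerfectColoring.Admissible D B t₀ →
        {c : ℤ × ℤ → Fin n | PerfectColoring.IsColoring D B c}.Finite) ∧
    -- one algorithm halts on every admissible input and outputs all the colorings
    (∃ construct : PerfectColoring.Input →. List (List (List ℕ)), Partrec construct ∧
      ∀ (n : ℕ) (D : Finset (ℤ × ℤ)) (B : Matrix (Fin n) (Fin n) ℕ) (t₀ : ℤ),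
        PerfectColoring.Admissible D B t₀ →
          ∀ L : List (ℤ × ℤ), L.toFinset = D →
            ∃ out ∈ construct (L, PerfectColoring.rows B, t₀),
              PerfectColoring.ListsAllColorings D B out) ∧
    -- one algorithm halts on every admissible input and decides whether a coloring exists
    (∃ decideExistence : PerfectColoring.Input →. Bool, Partrec decideExistence ∧
      ∀ (n : ℕ) (D : Finset (ℤ × ℤ)) (B : Matrix (Fin n) (Fin n) ℕ) (t₀ : ℤ),
        PerfectColoring.Admissible D B t₀ →
          ∀ L : List (ℤ × ℤ), L.toFinset = D →
            ∃ b ∈ decideExistence (L, PerfectColoring.rows B, t₀),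
              (b = true ↔ ∃ c : ℤ × ℤ → Fin n, PerfectColoring.IsColoring D B c)) := by
  refine ⟨fun n D B t₀ h => h.finite_colorings,
    ⟨PerfectColoring.construct, PerfectColoring.partrec_construct,
      fun n D B t₀ h L hL => h.exists_mem_construct hL⟩,
    ⟨fun x => (PerfectColoring.construct x).map fun out => decide (out ≠ []), ?_, ?_⟩⟩
  · refine PerfectColoring.partrec_construct.map (Primrec.to_comp ?_)
    exact (Primrec.eq.comp Primrec.snd (Primrec.const [])).not.decide
  · intro n D B t₀ h L hL
    obtain ⟨out, hout, hlist⟩ := h.exists_mem_construct hL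
    exact ⟨_, Part.mem_map _ hout, by rw [decide_eq_true_iff]; exact hlist.ne_nil_iff⟩
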